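/- For a matroid $M$ with finite ground set $E(M)$ and an integer $k \ge 0$, say that $M$ is $k$-colourable if $E(M)$ is the union of $k$ pairwise disjoint (possibly empty) independent sets, and let $\chi(M)$, the colouring number of $M$, be the least such $k$. For an integer $b \ge 1$ and a real number $c \ge 1$, say that $M$ is $(b,c)$-decomposable if there is a partition $E(M) = E_1 \cup \dots \cup E_\ell$ into an arbitrary number of pairwise disjoint nonempty classes such that (i) $|E_i| \le c\,\chi(M)$ for all $i$, and (ii) for every transversal $Y = \{y_1,\dots,y_\ell\}$ with $y_i \in E_i$ for all $i$, the restriction $M|Y$ is $b$-colourable. Let $\mathrm{PG}(n-1,q)$ be the rank-$n$ projective geometry over the field with $q$ elements, viewed as a matroid: its elements are the one-dimensional subspaces of $\mathbb{F}_q^n$, and a set of them is independent if vectors spanning them are linearly independent. For $p \in (0,1]$, let $\mathrm{PG}_p(n-1,q)$ be the restriction of $\mathrm{PG}(n-1,q)$ to a random set of points that contains each point independently with probability $p$. **Theorem.** Let $q \ge 2$ be a prime power, let $p \in (0,1]$, let $b \ge 1$ be an integer and let $c \ge 1$ be a real number. Then $$\lim_{n \to \infty} \mathbb{P}\bigl(\mathrm{PG}_p(n-1,q)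 \text{ is not } (b,c)\text{-decomposable}\bigr) = 1.$$ -/

import Mathlib

open scoped LinearAlgebra.Projectivization

/-- `M` is `k`-colourable: its ground set splits into `k` pairwise disjoint independent sets
(some of which may be empty). -/
def Matroid.IsColourable {α : Type*} (M : Matroid α) (k : ℕ) : Prop :=
  ∃ I : Fin k → Set α,
    (∀ i, M.Indep (I i)) ∧ Pairwise (fun i j => Disjoint (I i) (I j)) ∧ (⋃ i, I i) = M.E

/-- The colouring number `χ(M)`: the least `k` such that `M` is `k`-colourable. (Such a `k` exists
for every finite loopless matroid, in particular for every restriction of a finite projective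
geometry.) -/
noncomputable def Matroid.colouringNumber {α : Type*} (M : Matroid α) : ℕ :=
  sInf {k : ℕ | M.IsColourable k}

/-- `E₁, …, E_ℓ` is a `(b,c)`-decomposition of `M`: a partition of the ground set into nonempty
classes, each of size at most `c χ(M)`, such that for every transversal `Y = {y₁, …, y_ℓ}`,
`yᵢ ∈ Eᵢ`, the restriction `M | Y` is `b`-colourable. -/
structure Matroid.IsDecomposition {α : Type*} (M : Matroid α) (b : ℕ) (c : ℝ) {l : ℕ}
    (E : Fin l → Set α) : Prop where
  nonempty : ∀ i, (E i).Nonempty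
  disjoint : Pairwise (fun i j => Disjoint (E i) (E j))
  iUnion_eq : (⋃ i, E i) = M.E
  card_le : ∀ i, ((E i).ncard : ℝ) ≤ c * M.colouringNumber
  transversal : ∀ y : Fin l → α, (∀ i, y i ∈ E i) → (M.restrict (Set.range y)).IsColourable b

/-- `M` is `(b,c)`-decomposable. -/
def Matroid.IsDecomposable {α : Type*} (M : Matroid α) (b : ℕ) (c : ℝ) : Prop :=
  ∃ (l : ℕ) (E : Fin l → Set α), M.IsDecomposition b c E

/-- The augmentation axiom for independent sets of points of a finite projective space. -/
theorem Projectivization.independent_augment {F V : Type*} [Field F] [AddCommGroup V] [Module F V]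
    [Finite (ℙ F V)] ⦃I J : Set (ℙ F V)⦄
    (hI : Projectivization.Independent (fun x : I => (x : ℙ F V)))
    (hJ : Projectivization.Independent (fun x : J => (x : ℙ F V)))
    (h : I.ncard < J.ncard) :
    ∃ e ∈ J, e ∉ I ∧
      Projectivization.Independent (fun x : (insert e I : Set (ℙ F V)) => (x : ℙ F V)) := by
  classical
  rw [Projectivization.independent_iff] at hI hJ
  simp only [Projectivization.independent_iff]
  by_contra! hc
  have hI' : LinearIndepOn F (Projectivization.rep : ℙ F V → V) I := hI
  have hspan : ∀ e ∈ J, e.rep ∈ Submodule.span F (Projectivization.rep '' I) := by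
    intro e he
    by_cases heI : e ∈ I
    · exact Submodule.subset_span ⟨e, heI, rfl⟩
    · by_contra hn
      exact hc e he heI (hI'.insert hn)
  have hfin : (Projectivization.rep '' I).Finite := Set.toFinite _
  have := Module.Finite.span_of_finite F hfin
  have hle : J.ncard ≤ Module.finrank F (Submodule.span F (Projectivization.rep '' I)) := by
    have hli : LinearIndependent F
        (fun x : J => (⟨x.1.rep, hspan x.1 x.2⟩ :
          Submodule.span F (Projectivization.rep '' I))) :=
      LinearIndependent.of_comp (Submodule.span F (Projectivization.rep '' I)).subtype hJ
    have := Fintype.ofFinite J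
    have := hli.fintype_card_le_finrank
    rwa [← Nat.card_eq_fintype_card, Nat.card_coe_set_eq] at this
  have h2 : Module.finrank F (Submodule.span F (Projectivization.rep '' I)) ≤ I.ncard := by
    have := Fintype.ofFinite (Projectivization.rep '' I)
    refine (finrank_span_le_card _).trans ?_
    rw [← Set.ncard_eq_toFinset_card']
    exact Set.ncard_image_le (Set.toFinite I)
  omega

/-- The rank-`n` projective geometry `PG(n-1,q)` over the field `F` with `q` elements, as a matroid:
its elements are the points of the projective space of `Fⁿ`, and a set of points is independent
if and only if vectors representing its points are linearly independent. -/
noncomputable def projectiveGeometry (F : Type*) [Field F] [Finite F] (n : ℕ) :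
    Matroid (ℙ F (Fin n → F)) :=
  (IndepMatroid.ofFinite (E := Set.univ) Set.finite_univ
    (fun I => Projectivization.Independent (fun x : I => (x : ℙ F (Fin n → F))))
    (by
      rw [Projectivization.independent_iff]
      exact linearIndependent_empty_type)
    (by
      intro I J hJ hIJ
      rw [Projectivization.independent_iff] at hJ ⊢
      exact LinearIndepOn.mono (v := Projectivization.rep) hJ hIJ)
    Projectivization.independent_augment
    (fun _ _ => Set.subset_univ _)).matroid

/-!
Let `q = |F|`. Only the size of the random set matters: by Chebyshev's inequality
(`setBernoulli_ncard_lt_le`) it has, with probability tending to one, density at least a fixed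
`θ > 0` in `Fⁿ`, and for large `n` no set of points `S` of density at least `θ` is decomposable
(`eventually_not_isDecomposable`).

For the latter, consider a decomposition of `S`. Its number of classes is at most `b n`, because a
transversal contains one point of each class and is covered by `b` independent sets. The colouring
number of `S` is at most `6 qⁿ / n`, by greedily removing independent sets of size `n / 2`
(`colouringNumber_restrict_mul_le`), so no class has more than `6 c qⁿ / n` elements. Classes with
fewer than `δ qⁿ / n` elements, for `δ = θ / (2 b)`, cover at most half of `S`, and therefore at
least `θ n / (12 c)` classes are larger than that (`le_card_large_classes`).

A subspace spanned by `k + 1` random vectors, with `k` a small multiple of `n`, contains the image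
of a random affine map `Fᵏ → Fⁿ`. The values of this map are pairwise independent, so by the second
moment method it misses a given large class with probability at most `n / (δ qᵏ)`, which is
exponentially small (`card_affine_miss_le`). Hence some subspace `W` of dimension at most `k + 1`
meets all large classes at once (`exists_submodule_meets_all`). A transversal that picks its points
from `W` wherever possible has more than `b (k + 1)` points in `W`, which `b` independent sets
cannot cover (`card_le_mul_finrank_of_meets`).
-/

/-! ### Random affine images of `Fᵏ` -/

/-- For `z ≠ 0` the vector `∑ zᵢ Tᵢ` is uniformly distributed when the `Tᵢ` are, so a mean-zero
function of it averages to zero. -/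
theorem sum_comp_linearCombination_eq_zero {F V : Type*} [Field F] [AddCommGroup V] [Module F V]
    [Fintype V] {k : ℕ} {z : Fin k → F} (hz : z ≠ 0) {g : V → ℝ} (hg : ∑ d, g d = 0) :
    ∑ T : Fin k → V, g (∑ i, z i • T i) = 0 := by
  classical
  obtain ⟨i₀, hi₀⟩ : ∃ i, z i ≠ 0 := by
    by_contra! h
    exact hz (funext h)
  -- Shifting the single vector `T i₀` realises every translation of `∑ zᵢ Tᵢ`.
  have hshift (u : V) : ∑ T : Fin k → V, g (∑ i, z i • T i) =
      ∑ T : Fin k → V, g (∑ i, z i • T i + u) := by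
    rw [← Equiv.sum_comp (Equiv.addRight (Pi.single i₀ ((z i₀)⁻¹ • u) : Fin k → V))]
    refine Finset.sum_congr rfl fun T _ => ?_
    congr 1
    simp only [Equiv.coe_addRight, Pi.add_apply, smul_add, Finset.sum_add_distrib]
    congr 1
    rw [Finset.sum_eq_single i₀]
    · rw [Pi.single_eq_same, smul_inv_smul₀ hi₀]
    · intro i _ hi
      simp [Pi.single_eq_of_ne hi]
    · simp
  have hsum : (Fintype.card V : ℝ) * ∑ T : Fin k → V, g (∑ i, z i • T i) = 0 := by
    calc (Fintype.card V : ℝ) * ∑ T : Fin k → V, g (∑ i, z i • T i)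
        = ∑ u : V, ∑ T : Fin k → V, g (∑ i, z i • T i + u) := by
          rw [← Finset.sum_congr rfl fun u _ => hshift u]
          simp
      _ = ∑ T : Fin k → V, ∑ u : V, g (∑ i, z i • T i + u) := Finset.sum_comm
      _ = 0 := by
          refine Finset.sum_eq_zero fun T _ => ?_
          exact (Equiv.sum_comp (Equiv.addLeft (∑ i, z i • T i)) g).trans hg
  have hV : (Fintype.card V : ℝ) ≠ 0 := by
    have : Nonempty V := ⟨0⟩
    exact_mod_cast Fintype.card_ne_zero
  exact (mul_eq_zero.mp hsum).resolve_left hV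

/-- Pairwise independence of the values of a random affine map `x ↦ v + ∑ xᵢ Tᵢ`, in the form:
the correlation of a mean-zero function at two distinct arguments vanishes. -/
theorem sum_affine_mul_affine_eq_zero {F V : Type*} [Field F] [AddCommGroup V] [Module F V]
    [Fintype V] {k : ℕ} {x y : Fin k → F} (hxy : x ≠ y) {f : V → ℝ} (hf : ∑ d, f d = 0) :
    ∑ ω : V × (Fin k → V), f (ω.1 + ∑ i, x i • ω.2 i) * f (ω.1 + ∑ i, y i • ω.2 i) = 0 := by
  rw [Fintype.sum_prod_type_right]
  have h (T : Fin k → V) :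
      ∑ v : V, f (v + ∑ i, x i • T i) * f (v + ∑ i, y i • T i) =
        (fun d => ∑ u, f u * f (u + d)) (∑ i, (y - x) i • T i) := by
    refine Eq.trans ?_ (Equiv.sum_comp (Equiv.addRight (∑ i, x i • T i))
      (fun u => f u * f (u + ∑ i, (y - x) i • T i)))
    refine Finset.sum_congr rfl fun v _ => ?_
    simp only [Equiv.coe_addRight, Pi.sub_apply, sub_smul, Finset.sum_sub_distrib]
    congr 2
    abel
  simp only [h]
  refine sum_comp_linearCombination_eq_zero (sub_ne_zero.mpr hxy.symm)
    (g := fun d => ∑ u, f u * f (u + d)) ?_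
  rw [Finset.sum_comm]
  refine Finset.sum_eq_zero fun u _ => ?_
  rw [← Finset.mul_sum, show ∑ v, f (u + v) = 0 from
    (Equiv.sum_comp (Equiv.addLeft u) f).trans hf, mul_zero]

/-- Second moment bound: at most a fraction `|V| / (|F|ᵏ |A|)` of the affine maps `Fᵏ → V` have an
image that misses `A`. -/
theorem card_affine_miss_le {F V : Type*} [Field F] [Fintype F] [AddCommGroup V] [Module F V]
    [Fintype V] [DecidableEq V] (k : ℕ) (A : Finset V) :
    ((Finset.univ.filter fun ω : V × (Fin k → V) =>
        ∀ x : Fin k → F, ω.1 + ∑ i, x i • ω.2 i ∉ A).card : ℝ) *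
      ((Fintype.card F : ℝ) ^ k * A.card) ≤
    Fintype.card (V × (Fin k → V)) * Fintype.card V := by
  classical
  set Q : ℝ := (Fintype.card F : ℝ) ^ k with hQ
  have hQpos : 0 < Q := by
    have := Fintype.card_pos (α := F)
    positivity
  set N : ℝ := (Fintype.card V : ℝ) with hN
  have hNpos : 0 < N := by
    have : Nonempty V := ⟨0⟩
    have := Fintype.card_pos (α := V)
    positivity
  rcases A.eq_empty_or_nonempty with rfl | hA
  · simp; positivity
  set α : ℝ := A.card / N with hα
  have hαpos : 0 < α := by
    have := hA.card_pos
    positivity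
  -- The indicator function of `A`, centred; if the image misses `A`, the values of `f` on it sum
  -- to `- Q * α`.
  set f : V → ℝ := fun v => (if v ∈ A then 1 else 0) - α with hf
  have hf0 : ∑ v, f v = 0 := by
    simp only [hf, Finset.sum_sub_distrib, Finset.sum_const, Finset.card_univ, nsmul_eq_mul,
      Finset.sum_ite_mem, Finset.univ_inter]
    rw [← hN, hα]
    field_simp
    simp
  have hf2 : ∑ v, f v * f v ≤ A.card := by
    have h1 : ∀ v, f v * f v = (if v ∈ A then 1 else 0) - α * (if v ∈ A then 1 else 0)
        - α * f v := by
      intro v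
      simp only [hf]
      split_ifs <;> ring
    simp only [h1, Finset.sum_sub_distrib, ← Finset.mul_sum, hf0]
    simp only [Finset.sum_const, nsmul_eq_mul, Finset.sum_ite_mem, Finset.univ_inter]
    nlinarith [show (0 : ℝ) ≤ A.card from Nat.cast_nonneg _]
  set Ω := V × (Fin k → V)
  set e : Ω → (Fin k → F) → V := fun ω x => ω.1 + ∑ i, x i • ω.2 i with he
  have hsecond : ∑ ω : Ω, (∑ x, f (e ω x)) ^ 2 ≤ Fintype.card (Fin k → V) * Q * A.card := by
    calc ∑ ω : Ω, (∑ x, f (e ω x)) ^ 2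
        = ∑ x, ∑ y, ∑ ω : Ω, f (e ω x) * f (e ω y) := by
          simp only [sq, Finset.sum_mul_sum]
          rw [Finset.sum_comm]
          exact Finset.sum_congr rfl fun x _ => Finset.sum_comm
      -- Only the diagonal terms survive.
      _ = ∑ x, ∑ ω : Ω, f (e ω x) * f (e ω x) := by
          refine Finset.sum_congr rfl fun x _ => ?_
          rw [Finset.sum_eq_single x]
          · exact fun y _ hy => sum_affine_mul_affine_eq_zero hy.symm hf0
          · simp
      _ = ∑ x : Fin k → F, Fintype.card (Fin k → V) * ∑ v, f v * f v := by
          refine Finset.sum_congr rfl fun x _ => ?_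
          rw [Fintype.sum_prod_type_right]
          rw [Finset.sum_congr rfl fun T _ => Equiv.sum_comp (Equiv.addRight (∑ i, x i • T i))
            (fun u => f u * f u)]
          simp
      _ = Fintype.card (Fin k → V) * Q * ∑ v, f v * f v := by
          simp only [Finset.sum_const, Finset.card_univ, nsmul_eq_mul, Fintype.card_fun,
            Fintype.card_fin, Nat.cast_pow, hQ]
          ring
      _ ≤ _ := by gcongr
  set B := Finset.univ.filter fun ω : Ω => ∀ x : Fin k → F, e ω x ∉ A with hB
  have hlow : (B.card : ℝ) * (Q * α) ^ 2 ≤ ∑ ω : Ω, (∑ x, f (e ω x)) ^ 2 := by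
    calc (B.card : ℝ) * (Q * α) ^ 2 = ∑ ω ∈ B, (∑ x, f (e ω x)) ^ 2 := by
          rw [← nsmul_eq_mul, ← Finset.sum_const]
          refine Finset.sum_congr rfl fun ω hω => ?_
          have h := (Finset.mem_filter.mp hω).2
          have : ∑ x, f (e ω x) = - (Q * α) := by
            simp [hf, h, hQ]
          rw [this]; ring
      _ ≤ _ := Finset.sum_le_univ_sum_of_nonneg fun _ => sq_nonneg _
  have hcard : (Fintype.card Ω : ℝ) = N * Fintype.card (Fin k → V) := by
    simp [Ω, Fintype.card_prod, hN]
  have hAα : (A.card : ℝ) = α * N := by rw [hα]; field_simp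
  have hmain := hlow.trans hsecond
  rw [hcard]
  rw [hAα] at hmain ⊢
  have : (B.card : ℝ) * (Q * α) * (Q * α) ≤ Fintype.card (Fin k → V) * N * (Q * α) := by
    nlinarith
  have := le_of_mul_le_mul_right this (mul_pos hQpos hαpos)
  nlinarith

/-- If the sets `A j` are all large, some subspace of dimension at most `k + 1` meets every one of
them. -/
theorem exists_submodule_meets_all {F V : Type*} [Field F] [Fintype F] [AddCommGroup V] [Module F V]
    [Fintype V] {ι : Type*} (L : Finset ι) (A : ι → Finset V) (k : ℕ) {a : ℝ}
    (hA : ∀ j ∈ L, a ≤ (A j).card)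
    (hlarge : (L.card : ℝ) * Fintype.card V < (Fintype.card F : ℝ) ^ k * a) :
    ∃ W : Submodule F V, Module.finrank F W ≤ k + 1 ∧ ∀ j ∈ L, ∃ v ∈ A j, v ∈ W := by
  classical
  have hQpos : 0 < (Fintype.card F : ℝ) ^ k := by
    have := Fintype.card_pos (α := F)
    positivity
  set B : ι → Finset (V × (Fin k → V)) := fun j => Finset.univ.filter fun ω =>
    ∀ x : Fin k → F, ω.1 + ∑ i, x i • ω.2 i ∉ A j with hB
  obtain ⟨ω, hω⟩ : ∃ ω, ω ∉ L.biUnion B := by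
    by_contra! h
    have hle : (Fintype.card (V × (Fin k → V)) : ℝ) ≤ ∑ j ∈ L, ((B j).card : ℝ) := by
      rw [← Finset.card_univ, ← Finset.eq_univ_of_forall h]
      exact_mod_cast Finset.card_biUnion_le
    have hpos : (0 : ℝ) < Fintype.card (V × (Fin k → V)) := by
      have : Nonempty V := ⟨0⟩
      exact_mod_cast Fintype.card_pos
    have hs : (∑ j ∈ L, ((B j).card : ℝ)) * ((Fintype.card F : ℝ) ^ k * a) ≤
        L.card * (Fintype.card (V × (Fin k → V)) * Fintype.card V) := by
      rw [Finset.sum_mul, ← nsmul_eq_mul, ← Finset.sum_const]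
      refine Finset.sum_le_sum fun j hj => le_trans ?_ (card_affine_miss_le (F := F) k (A j))
      have := hA j hj
      gcongr
    have hpa : 0 ≤ (Fintype.card F : ℝ) ^ k * a := le_trans (by positivity) hlarge.le
    nlinarith [mul_le_mul_of_nonneg_right hle hpa, mul_lt_mul_of_pos_left hlarge hpos]
  refine ⟨Submodule.span F (Set.range (Fin.cons ω.1 ω.2 : Fin (k + 1) → V)), ?_, fun j hj => ?_⟩
  · exact (finrank_range_le_card (R := F) _).trans (by simp)
  · have hj' : ω ∉ B j := fun h => hω (Finset.mem_biUnion.mpr ⟨j, hj, h⟩)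
    simp only [hB, Finset.mem_filter, Finset.mem_univ, true_and, not_forall, not_not] at hj'
    obtain ⟨x, hx⟩ := hj'
    refine ⟨_, hx, ?_⟩
    refine Submodule.add_mem _ (Submodule.subset_span ⟨0, rfl⟩) ?_
    exact Submodule.sum_mem _ fun i _ =>
      Submodule.smul_mem _ _ (Submodule.subset_span ⟨i.succ, rfl⟩)

/-! ### Colourings of projective geometries -/

theorem Projectivization.rep_injective {F V : Type*} [Field F] [AddCommGroup V] [Module F V] :
    Function.Injective (Projectivization.rep : ℙ F V → V) := fun x y h => by
  rw [← x.mk_rep, ← y.mk_rep]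
  simp only [h]

theorem projectiveGeometry_indep_iff {F : Type*} [Field F] [Finite F] {n : ℕ}
    {I : Set (ℙ F (Fin n → F))} :
    (projectiveGeometry F n).Indep I ↔ LinearIndepOn F Projectivization.rep I := by
  change Projectivization.Independent (fun x : I => (x : ℙ F (Fin n → F))) ↔ _
  rw [Projectivization.independent_iff]
  rfl

/-- A set of more than `|F|ᵐ` points has rank greater than `m`, so it contains `m` independent
points. -/
theorem exists_linearIndepOn_ncard_eq {F V : Type*} [Field F] [Finite F] [AddCommGroup V]
    [Module F V] [Finite V] {m : ℕ} {S : Set (ℙ F V)} (hS : Nat.card F ^ m < S.ncard) :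
    ∃ I ⊆ S, LinearIndepOn F Projectivization.rep I ∧ I.ncard = m := by
  obtain ⟨B, hBS, -, hspan, hB⟩ := exists_linearIndepOn_extension
    (K := F) (v := (Projectivization.rep : ℙ F V → V)) (linearIndepOn_empty F _)
    (Set.empty_subset S)
  have hcard : S.ncard ≤ Nat.card F ^ B.ncard := by
    have := Fintype.ofFinite B
    calc S.ncard = (Projectivization.rep '' S).ncard :=
          (Set.ncard_image_of_injective _ Projectivization.rep_injective).symm
      _ ≤ (Submodule.span F (Projectivization.rep '' B) : Set V).ncard :=
          Set.ncard_le_ncard hspan (Set.toFinite _)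
      _ = Nat.card F ^ Module.finrank F (Submodule.span F (Projectivization.rep '' B)) :=
          Module.natCard_eq_pow_finrank
      _ = Nat.card F ^ B.ncard := by
          have h := finrank_span_eq_card hB
          rw [Set.image_eq_range, h, ← Nat.card_eq_fintype_card, Nat.card_coe_set_eq]
  have hm : m ≤ B.ncard := by
    by_contra! h
    have := Nat.pow_le_pow_right (Nat.card_pos (α := F)) h.le
    omega
  obtain ⟨I, hIB, hI⟩ := Set.exists_subset_card_eq hm
  exact ⟨I, hIB.trans hBS, hB.mono hIB, hI⟩

/-- Greedy colouring: independent sets of size `m` are removed as long as more than `|F|ᵐ` points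
are left, and the remaining points get a colour each. -/
theorem exists_isColourable_restrict {F : Type*} [Field F] [Finite F] {n m : ℕ} (hm : 0 < m)
    (S : Set (ℙ F (Fin n → F))) :
    ∃ k, k * m ≤ S.ncard + m * Nat.card F ^ m ∧
      ((projectiveGeometry F n).restrict S).IsColourable k := by
  induction hN : S.ncard using Nat.strong_induction_on generalizing S with
  | _ N ih =>
  subst hN
  rcases Nat.lt_or_ge (Nat.card F ^ m) S.ncard with hS | hS
  · obtain ⟨I, hIS, hI, hIm⟩ := exists_linearIndepOn_ncard_eq hS
    have hdiff : (S \ I).ncard = S.ncard - m := by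
      rw [Set.ncard_sdiff hIS, hIm]
    have hIle : m ≤ S.ncard := hIm ▸ Set.ncard_le_ncard hIS
    obtain ⟨k, hk, J, hJ, hdisj, hU⟩ := ih (S \ I).ncard (by omega) (S \ I) rfl
    refine ⟨k + 1, by rw [hdiff] at hk; rw [add_mul]; omega, Fin.cons I J, ?_, ?_, ?_⟩
    · refine Fin.cases ?_ fun i => ?_
      · exact Matroid.restrict_indep_iff.mpr ⟨projectiveGeometry_indep_iff.mpr hI, hIS⟩
      · have := Matroid.restrict_indep_iff.mp (hJ i)
        exact Matroid.restrict_indep_iff.mpr ⟨this.1, this.2.trans Set.sdiff_subset⟩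
    · have hIJ (i : Fin k) : Disjoint I (J i) :=
        Set.disjoint_sdiff_right.mono_right (Matroid.restrict_indep_iff.mp (hJ i)).2
      refine Fin.cases (Fin.cases ?_ fun j _ => ?_) fun i => Fin.cases (fun _ => ?_) fun j hij => ?_
      · exact fun h => absurd rfl h
      · exact hIJ j
      · exact (hIJ i).symm
      · exact hdisj fun h => hij (congrArg _ h)
    · rw [Matroid.restrict_ground_eq] at hU ⊢
      have h : (⋃ i, (Fin.cons I J : Fin (k + 1) → Set (ℙ F (Fin n → F))) i) = I ∪ ⋃ i, J i := by
        ext x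
        simp
      rw [h, hU, Set.union_sdiff_cancel hIS]
  · refine ⟨S.ncard, by nlinarith, ?_⟩
    have e := (Finite.equivFinOfCardEq (Nat.card_coe_set_eq S)).symm
    refine ⟨fun i => {(e i : ℙ F (Fin n → F))}, fun i => ?_, fun i j hij => ?_, ?_⟩
    · refine Matroid.restrict_indep_iff.mpr ⟨projectiveGeometry_indep_iff.mpr ?_, by simp⟩
      exact LinearIndepOn.singleton (Projectivization.rep_nonzero _)
    · simpa [Set.disjoint_singleton, Subtype.coe_inj] using hij
    · ext x
      simp only [Set.mem_iUnion, Set.mem_singleton_iff, Matroid.restrict_ground_eq]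
      exact ⟨fun ⟨i, hi⟩ => hi ▸ (e i).2, fun hx => ⟨e.symm ⟨x, hx⟩, by simp⟩⟩

theorem ncard_le_card_pow {F : Type*} [Field F] [Finite F] {n : ℕ} (S : Set (ℙ F (Fin n → F))) :
    S.ncard ≤ Nat.card F ^ n := by
  calc S.ncard ≤ Nat.card (ℙ F (Fin n → F)) := Set.ncard_le_card S
    _ ≤ Nat.card (Fin n → F) := Nat.card_le_card_of_injective _ Projectivization.rep_injective
    _ = Nat.card F ^ n := by simp [Nat.card_fun]

/-- Greedy colouring with independent sets of size `n / 2`: the colouring number of every restriction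
is of order at most `qⁿ / n`. -/
theorem colouringNumber_restrict_mul_le {F : Type*} [Field F] [Finite F] {n : ℕ} (hn : 2 ≤ n)
    (S : Set (ℙ F (Fin n → F))) :
    ((projectiveGeometry F n).restrict S).colouringNumber * n ≤ 6 * Nat.card F ^ n := by
  obtain ⟨k, hk, hcol⟩ := exists_isColourable_restrict (m := n / 2) (by omega) S
  have hF : 2 ≤ Nat.card F := Finite.one_lt_card
  have hm : n / 2 * Nat.card F ^ (n / 2) ≤ Nat.card F ^ n :=
    calc n / 2 * Nat.card F ^ (n / 2) ≤ Nat.card F ^ (n / 2) * Nat.card F ^ (n / 2) :=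
          Nat.mul_le_mul_right _ (Nat.lt_pow_self hF).le
      _ = Nat.card F ^ (n / 2 + n / 2) := (pow_add _ _ _).symm
      _ ≤ Nat.card F ^ n := Nat.pow_le_pow_right (by omega) (by omega)
  have hS := ncard_le_card_pow S
  calc _ ≤ k * n := Nat.mul_le_mul_right _ (Nat.sInf_le hcol)
    _ ≤ k * (3 * (n / 2)) := Nat.mul_le_mul_left _ (by omega)
    _ = 3 * (k * (n / 2)) := by ring
    _ ≤ _ := by omega

/-- In a `b`-colourable restriction every subspace `W` contains at most `b * dim W` points. -/
theorem ncard_le_mul_finrank_of_isColourable {F : Type*} [Field F] [Finite F] {n b : ℕ}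
    {E Y T : Set (ℙ F (Fin n → F))}
    (hcol : (((projectiveGeometry F n).restrict E).restrict Y).IsColourable b)
    (W : Submodule F (Fin n → F)) (hTY : T ⊆ Y) (hTW : ∀ x ∈ T, x.rep ∈ W) :
    T.ncard ≤ b * Module.finrank F W := by
  obtain ⟨I, hI, -, hU⟩ := hcol
  rw [Matroid.restrict_ground_eq] at hU
  have hle (i : Fin b) : (T ∩ I i).ncard ≤ Module.finrank F W := by
    have h1 : LinearIndepOn F Projectivization.rep (T ∩ I i) :=
      (projectiveGeometry_indep_iff.mp (Matroid.restrict_indep_iff.mp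
        (Matroid.restrict_indep_iff.mp (hI i)).1).1).mono Set.inter_subset_right
    have h2 : LinearIndependent F
        (fun x : (T ∩ I i : Set _) => (⟨x.1.rep, hTW x.1 x.2.1⟩ : W)) :=
      LinearIndependent.of_comp W.subtype h1
    have := Fintype.ofFinite (T ∩ I i : Set _)
    have h3 := h2.fintype_card_le_finrank
    rwa [← Nat.card_eq_fintype_card, Nat.card_coe_set_eq] at h3
  have hT : T = ⋃ i, T ∩ I i := by
    rw [← Set.inter_iUnion, hU, Set.inter_eq_left.mpr hTY]
  calc T.ncard = (⋃ i, T ∩ I i).ncard := by rw [← hT]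
    _ ≤ ∑ i, (T ∩ I i).ncard := Set.ncard_iUnion_le_of_fintype _
    _ ≤ ∑ _i : Fin b, Module.finrank F W := Finset.sum_le_sum fun i _ => hle i
    _ = b * Module.finrank F W := by simp

/-! ### The size of the random set -/

section

open MeasureTheory ProbabilityTheory unitInterval

/-- Chebyshev's inequality for the size of a `p`-random subset of a finite set. -/
theorem setBernoulli_ncard_lt_le {ι : Type*} [Finite ι] (p : unitInterval) (hp : 0 < p)
    (hι : 0 < Nat.card ι) :
    setBernoulli (Set.univ : Set ι) p {E : Set ι | (E.ncard : ℝ) < p / 2 * Nat.card ι} ≤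
      ENNReal.ofReal (4 / ((p : ℝ) ^ 2 * Nat.card ι)) := by
  classical
  have := Fintype.ofFinite ι
  set ν : Measure Prop := toNNReal p • Measure.dirac True + toNNReal (σ p) • Measure.dirac False
    with hν
  have : IsProbabilityMeasure ν := by rw [hν]; infer_instance
  set X : Prop → ℝ := fun P => if P then 1 else 0 with hX
  have hXm : MemLp X 2 ν := by
    refine MemLp.of_bound (Measurable.of_discrete).aestronglyMeasurable 1 ?_
    refine Filter.Eventually.of_forall fun P => ?_
    simp only [hX]; split_ifs <;> simp
  have hint : ∫ P, X P ∂ν = p := by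
    rw [hν, integral_add_measure]
    · simp [hX, NNReal.smul_def]
    · exact (integrable_dirac (by simp)).smul_measure (by simp)
    · exact (integrable_dirac (by simp)).smul_measure (by simp)
  have hvar : Var[X; ν] ≤ 1 := by
    refine (variance_le_sq_of_bounded (a := 0) (b := 1) ?_ ?_).trans (by norm_num)
    · refine Filter.Eventually.of_forall fun P => ?_
      simp only [hX]; split_ifs <;> simp
    · exact (Measurable.of_discrete).aemeasurable
  set μ : Measure (ι → Prop) := Measure.pi fun _ => ν with hμ
  set S : (ι → Prop) → ℝ := ∑ i, fun ω => X (ω i) with hS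
  have hXi (i : ι) : MemLp (fun ω : ι → Prop => X (ω i)) 2 μ :=
    hXm.comp_measurePreserving (measurePreserving_eval _ i)
  have hSm : MemLp S 2 μ := memLp_finsetSum' _ fun i _ => hXi i
  have hSvar : Var[S; μ] ≤ Nat.card ι := by
    rw [hS, hμ, variance_sum_pi fun _ => hXm]
    refine (Finset.sum_le_sum fun i _ => hvar).trans ?_
    simp
  have hSint : ∫ ω, S ω ∂μ = p * Nat.card ι := by
    simp only [hS, Finset.sum_apply]
    rw [integral_finsetSum _ fun i _ => (hXi i).integrable (by norm_num)]
    have (i : ι) : ∫ ω : ι → Prop, X (ω i) ∂μ = p := by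
      have h := integral_map (μ := μ) (φ := Function.eval i) (f := X)
        (measurable_pi_apply i).aemeasurable (Measurable.of_discrete).aestronglyMeasurable
      rw [(measurePreserving_eval (fun _ : ι => ν) i).map_eq] at h
      exact h.symm.trans hint
    simp [this, mul_comm]
  have hp' : (0 : ℝ) < p := hp
  have hι' : (0 : ℝ) < Nat.card ι := by exact_mod_cast hι
  have hcheb := meas_ge_le_variance_div_sq hSm (c := p / 2 * Nat.card ι) (by positivity)
  rw [setBernoulli_apply', show (fun i : ι => toNNReal p • Measure.dirac (i ∈ (Set.univ : Set ι)) +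
    toNNReal (σ p) • Measure.dirac False) = fun _ => ν by simp [hν], Measure.infinitePi_eq_pi]
  refine (measure_mono ?_).trans (hcheb.trans (ENNReal.ofReal_le_ofReal ?_))
  · intro ω hω
    have hSω : S ω = ({i | ω i} : Set ι).ncard := by
      simp [hS, hX, Finset.sum_boole, Set.ncard_eq_toFinset_card']
    have hω' : (({i | ω i} : Set ι).ncard : ℝ) < p / 2 * Nat.card ι := hω
    rw [Set.mem_ofPred_eq, hSint, hSω, abs_sub_comm]
    refine le_trans ?_ (le_abs_self _)
    linarith
  · calc Var[S; μ] / (p / 2 * Nat.card ι) ^ 2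
        ≤ Nat.card ι / (p / 2 * Nat.card ι) ^ 2 := by gcongr
      _ = _ := by field_simp; norm_num

end

/-! ### Decompositions of dense restrictions -/

open Filter Topology

theorem Matroid.IsDecomposition.injective_of_mem {α : Type*} {M : Matroid α} {b l : ℕ} {c : ℝ}
    {E : Fin l → Set α} (hE : M.IsDecomposition b c E) {y : Fin l → α} (hy : ∀ i, y i ∈ E i) :
    Function.Injective y := fun i j hij => by
  by_contra h
  exact Set.disjoint_left.mp (hE.disjoint h) (hy i) (hij ▸ hy j)

/-- If the classes in `L` all meet a subspace `W`, a transversal can be chosen inside `W` on `L`,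
so there are at most `b * dim W` of them. -/
theorem card_le_mul_finrank_of_meets {F : Type*} [Field F] [Finite F] {n b l : ℕ} {c : ℝ}
    {S : Set (ℙ F (Fin n → F))} {E : Fin l → Set (ℙ F (Fin n → F))}
    (hE : ((projectiveGeometry F n).restrict S).IsDecomposition b c E)
    (W : Submodule F (Fin n → F)) (L : Finset (Fin l))
    (hL : ∀ i ∈ L, ∃ x ∈ E i, x.rep ∈ W) :
    L.card ≤ b * Module.finrank F W := by
  have hch (i : Fin l) : ∃ x ∈ E i, i ∈ L → x.rep ∈ W := by
    by_cases hi : i ∈ L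
    · obtain ⟨x, hx, hxW⟩ := hL i hi
      exact ⟨x, hx, fun _ => hxW⟩
    · obtain ⟨x, hx⟩ := hE.nonempty i
      exact ⟨x, hx, fun h => absurd h hi⟩
  choose y hy hyW using hch
  have h := ncard_le_mul_finrank_of_isColourable (hE.transversal y hy) W
    (T := y '' L) (Set.image_subset_range _ _) (by
      rintro _ ⟨i, hi, rfl⟩
      exact hyW i hi)
  rwa [Set.ncard_image_of_injective _ (hE.injective_of_mem hy), Set.ncard_coe_finset] at h

/-- The classes of density at least `δ / n` in a decomposition of a set of density `θ` number at
least `θ n / (12 c)`, if `δ = θ / (2 b)`: the at most `b n` classes cannot cover half of the set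
by small classes, and no class has density above `6 c / n`. -/
theorem le_card_large_classes {F : Type*} [Field F] [Finite F] {n b l : ℕ} {c θ : ℝ}
    (hn : 2 ≤ n) (hb : 1 ≤ b) (hc : 1 ≤ c) (hθ : 0 < θ)
    {S : Set (ℙ F (Fin n → F))} {E : Fin l → Set (ℙ F (Fin n → F))}
    (hE : ((projectiveGeometry F n).restrict S).IsDecomposition b c E)
    (hS : θ * (Nat.card F : ℝ) ^ n ≤ S.ncard) (L : Finset (Fin l))
    (hL : ∀ i ∉ L, ((E i).ncard : ℝ) < θ / (2 * b) * (Nat.card F : ℝ) ^ n / n) :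
    θ * n / (12 * c) ≤ L.card := by
  classical
  set Q : ℝ := (Nat.card F : ℝ) ^ n with hQ
  have hQpos : 0 < Q := by
    have := Nat.card_pos (α := F)
    positivity
  have hn0 : (0 : ℝ) < n := by positivity
  have hb0 : (0 : ℝ) < b := by positivity
  have hc0 : 0 < c := by positivity
  have hl : (l : ℝ) ≤ b * n := by
    have h := card_le_mul_finrank_of_meets hE ⊤ Finset.univ fun i _ =>
      (hE.nonempty i).imp fun x hx => ⟨hx, Submodule.mem_top⟩
    simp only [Finset.card_univ, Fintype.card_fin, finrank_top, Module.finrank_fin_fun] at h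
    exact_mod_cast h
  have hχ : (((projectiveGeometry F n).restrict S).colouringNumber : ℝ) ≤ 6 * Q / n := by
    rw [le_div_iff₀ hn0, hQ]
    exact_mod_cast colouringNumber_restrict_mul_le hn S
  have hsum : (S.ncard : ℝ) ≤ ∑ i, ((E i).ncard : ℝ) := by
    have h := hE.iUnion_eq
    rw [Matroid.restrict_ground_eq] at h
    rw [← h]
    exact_mod_cast Set.ncard_iUnion_le_of_fintype E
  have hlarge : ∑ i ∈ L, ((E i).ncard : ℝ) ≤ L.card * (c * (6 * Q / n)) := by
    rw [← nsmul_eq_mul, ← Finset.sum_const]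
    exact Finset.sum_le_sum fun i _ => (hE.card_le i).trans (by gcongr)
  have hsmall : ∑ i ∈ Lᶜ, ((E i).ncard : ℝ) ≤ b * n * (θ / (2 * b) * Q / n) := by
    calc ∑ i ∈ Lᶜ, ((E i).ncard : ℝ) ≤ ∑ i ∈ Lᶜ, θ / (2 * b) * Q / n :=
          Finset.sum_le_sum fun i hi => (hL i (Finset.mem_compl.mp hi)).le
      _ = (Lᶜ.card : ℝ) * (θ / (2 * b) * Q / n) := by rw [Finset.sum_const, nsmul_eq_mul]
      _ ≤ b * n * (θ / (2 * b) * Q / n) := by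
          refine mul_le_mul_of_nonneg_right (le_trans ?_ hl) (by positivity)
          exact_mod_cast (Finset.card_le_univ _).trans (Fintype.card_fin l).le
  have hhalf : b * n * (θ / (2 * b) * Q / n) = θ * Q / 2 := by field_simp
  rw [← Finset.sum_add_sum_compl L] at hsum
  have hfin : θ * Q / 2 ≤ L.card * (c * (6 * Q / n)) := by linarith
  rw [div_le_iff₀ (by positivity)]
  have : θ * n / 2 * Q ≤ L.card * (c * 6) * Q := by
    calc θ * n / 2 * Q = θ * Q / 2 * n := by ring
      _ ≤ L.card * (c * (6 * Q / n)) * n := by gcongr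
      _ = L.card * (c * 6) * Q := by field_simp
  have := le_of_mul_le_mul_right this hQpos
  linarith

/-- The exponential growth that lets a subspace of dimension proportional to `n` meet linearly many
classes of density of order `1 / n`. -/
theorem eventually_sq_mul_lt_two_pow_floor {β C : ℝ} (hβ : 0 < β) :
    ∀ᶠ n : ℕ in atTop, (n : ℝ) ^ 2 * C < 2 ^ ⌊β * n⌋₊ := by
  have h1 : Tendsto (fun m : ℕ => (m : ℝ) ^ 2 / 2 ^ m) atTop (𝓝 0) :=
    tendsto_pow_const_div_const_pow_of_one_lt 2 one_lt_two
  have hε : 0 < β ^ 2 / (2 * (|C| + 1)) := by positivity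
  have h2 : Tendsto (fun n : ℕ => ⌊β * n⌋₊ + 1) atTop atTop :=
    (tendsto_add_atTop_nat 1).comp (tendsto_nat_floor_atTop.comp
      (tendsto_natCast_atTop_atTop.const_mul_atTop hβ))
  filter_upwards [(h1.comp h2).eventually_lt_const hε] with n hn
  simp only [Function.comp_apply] at hn
  rw [div_lt_div_iff₀ (by positivity) (by positivity), pow_succ (2 : ℝ)] at hn
  have h3 : β * n ≤ ((⌊β * n⌋₊ + 1 : ℕ) : ℝ) := by
    push_cast
    exact (Nat.lt_floor_add_one _).le
  have h4 : β ^ 2 * (n : ℝ) ^ 2 ≤ ((⌊β * n⌋₊ + 1 : ℕ) : ℝ) ^ 2 := by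
    rw [← mul_pow]
    gcongr
  have h5 : β ^ 2 * ((n : ℝ) ^ 2 * (|C| + 1)) < β ^ 2 * 2 ^ ⌊β * n⌋₊ := by
    have := mul_le_mul_of_nonneg_right h4 (by positivity : (0 : ℝ) ≤ |C| + 1)
    linarith
  have h6 := lt_of_mul_lt_mul_left h5 (by positivity)
  nlinarith [le_abs_self C, sq_nonneg (n : ℝ)]

/-- Every set of points of density at least `θ` fails to be decomposable once `n` is large. -/
theorem eventually_not_isDecomposable {F : Type*} [Field F] [Finite F] {b : ℕ} {c θ : ℝ}
    (hb : 1 ≤ b) (hc : 1 ≤ c) (hθ : 0 < θ) :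
    ∀ᶠ n : ℕ in atTop, ∀ S : Set (ℙ F (Fin n → F)), θ * (Nat.card F : ℝ) ^ n ≤ S.ncard →
      ¬ ((projectiveGeometry F n).restrict S).IsDecomposable b c := by
  classical
  have := Fintype.ofFinite F
  have hb0 : (0 : ℝ) < b := by positivity
  have hc0 : 0 < c := by positivity
  -- `β` is chosen so that `b * (β n + 1)` stays below the number of large classes.
  have hβ : 0 < θ / (24 * b * c) := by positivity
  have hlin : ∀ᶠ n : ℕ in atTop, (b : ℝ) < θ / (24 * c) * n :=
    (tendsto_natCast_atTop_atTop.const_mul_atTop (by positivity)).eventually_gt_atTop _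
  filter_upwards [eventually_ge_atTop 2, hlin,
    eventually_sq_mul_lt_two_pow_floor (C := b / (θ / (2 * b))) hβ] with n hn hbn hpow S hS
  rintro ⟨l, E, hE⟩
  set k := ⌊θ / (24 * b * c) * n⌋₊ with hk
  set Q : ℝ := (Nat.card F : ℝ) ^ n with hQ
  have hF : (2 : ℝ) ≤ Nat.card F := by exact_mod_cast (Finite.one_lt_card : 1 < Nat.card F)
  have hQpos : 0 < Q := by positivity
  have hn0 : (0 : ℝ) < n := by positivity
  set L : Finset (Fin l) :=
    Finset.univ.filter fun i => θ / (2 * b) * Q / n ≤ ((E i).ncard : ℝ) with hLdef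
  have hLcard : θ * n / (12 * c) ≤ L.card :=
    le_card_large_classes hn hb hc hθ hE hS L fun i hi =>
      not_le.mp fun h => hi (Finset.mem_filter.mpr ⟨Finset.mem_univ i, h⟩)
  have hLle : (L.card : ℝ) ≤ b * n := by
    have h := card_le_mul_finrank_of_meets hE ⊤ L fun i _ =>
      (hE.nonempty i).imp fun x hx => ⟨hx, Submodule.mem_top⟩
    rw [finrank_top, Module.finrank_fin_fun] at h
    exact_mod_cast h
  obtain ⟨W, hWdim, hW⟩ := exists_submodule_meets_all (F := F) L
    (fun i => (Projectivization.rep '' E i).toFinite.toFinset) k (a := θ / (2 * b) * Q / n)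
    (fun i hi => by
      rw [← Set.ncard_eq_toFinset_card, Set.ncard_image_of_injective _
        Projectivization.rep_injective]
      exact (Finset.mem_filter.mp hi).2)
    (by
      rw [← Nat.card_eq_fintype_card, ← Nat.card_eq_fintype_card (α := F), Nat.card_fun,
        Nat.card_eq_fintype_card (α := Fin n), Fintype.card_fin, Nat.cast_pow, ← hQ]
      have h1 : (2 : ℝ) ^ k ≤ (Nat.card F : ℝ) ^ k := by gcongr
      have h2 := hpow.trans_le h1
      rw [← mul_div_assoc, div_lt_iff₀ (by positivity)] at h2
      calc (L.card : ℝ) * Q ≤ b * n * Q := by gcongr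
        _ = (n ^ 2 * b) * (Q / n) := by field_simp
        _ < (Nat.card F : ℝ) ^ k * (θ / (2 * b)) * (Q / n) := by gcongr
        _ = _ := by ring)
  have hle := card_le_mul_finrank_of_meets hE W L fun i hi => by
    obtain ⟨v, hv, hvW⟩ := hW i hi
    obtain ⟨x, hx, rfl⟩ := (Set.Finite.mem_toFinset _).mp hv
    exact ⟨x, hx, hvW⟩
  have hle' : (L.card : ℝ) ≤ b * (k + 1) := by
    exact_mod_cast hle.trans (Nat.mul_le_mul_left b hWdim)
  have hkle : (k : ℝ) ≤ θ / (24 * b * c) * n := Nat.floor_le (by positivity)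
  have hbk : b * (k : ℝ) ≤ θ / (24 * c) * n := by
    calc b * (k : ℝ) ≤ b * (θ / (24 * b * c) * n) := by gcongr
      _ = θ / (24 * c) * n := by field_simp
  have hsplit : θ * n / (12 * c) = θ / (24 * c) * n + θ / (24 * c) * n := by
    field_simp; norm_num
  linarith

/-! ### The random restriction -/

theorem card_pow_le_card_mul_card_projectivization {F : Type*} [Field F] [Finite F] {n : ℕ}
    (hn : 0 < n) :
    Nat.card F ^ n ≤ Nat.card F * Nat.card (ℙ F (Fin n → F)) := by
  obtain ⟨n, rfl⟩ := Nat.exists_eq_add_one.mpr hn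
  rw [Projectivization.card_of_finrank F _ (Module.finrank_fin_fun F), pow_succ',
    Finset.sum_range_succ]
  exact Nat.mul_le_mul_left _ (Nat.le_add_left _ _)

theorem mainTheorem1 (q : ℕ) (hq : IsPrimePow q)
    (F : Type*) [Field F] [Finite F] (hF : Nat.card F = q)
    (p : unitInterval) (hp : 0 < p)
    (b : ℕ) (hb : 1 ≤ b) (c : ℝ) (hc : 1 ≤ c) :
    Filter.Tendsto
      (fun n : ℕ =>
        ProbabilityTheory.setBernoulli (Set.univ : Set (ℙ F (Fin n → F))) p
          {E : Set (ℙ F (Fin n → F)) |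
            ¬ ((projectiveGeometry F n).restrict E).IsDecomposable b c})
      Filter.atTop (nhds 1) := by
  have hp' : (0 : ℝ) < p := hp
  have hq2 : (2 : ℝ) ≤ Nat.card F := by exact_mod_cast (Finite.one_lt_card : 1 < Nat.card F)
  have hcard (n : ℕ) (hn : 0 < n) :
      (Nat.card F : ℝ) ^ n / Nat.card F ≤ Nat.card (ℙ F (Fin n → F)) := by
    rw [div_le_iff₀' (by positivity)]
    exact_mod_cast card_pow_le_card_mul_card_projectivization (F := F) hn
  have hlim : Tendsto (fun n : ℕ => 1 - ENNReal.ofReal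
      (4 / ((p : ℝ) ^ 2 * ((Nat.card F : ℝ) ^ n / Nat.card F)))) atTop (𝓝 1) := by
    have h1 : Tendsto (fun n : ℕ => 4 / ((p : ℝ) ^ 2 * ((Nat.card F : ℝ) ^ n / Nat.card F)))
        atTop (𝓝 0) := by
      refine Tendsto.const_div_atTop ?_ 4
      refine Tendsto.const_mul_atTop (by positivity) (Tendsto.atTop_div_const (by positivity) ?_)
      exact tendsto_pow_atTop_atTop_of_one_lt (by linarith)
    have h2 := ENNReal.Tendsto.sub (tendsto_const_nhds (x := (1 : ENNReal)))
      (ENNReal.tendsto_ofReal h1) (Or.inl ENNReal.one_ne_top)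
    simpa using h2
  refine tendsto_of_tendsto_of_tendsto_of_le_of_le' hlim tendsto_const_nhds ?_
    (Eventually.of_forall fun n => MeasureTheory.prob_le_one)
  filter_upwards [eventually_gt_atTop 0, eventually_not_isDecomposable (F := F) hb hc
    (θ := (p : ℝ) / 2 / Nat.card F) (by positivity)] with n hn hdec
  have hN := hcard n hn
  have hN0 : (0 : ℝ) < Nat.card (ℙ F (Fin n → F)) := lt_of_lt_of_le (by positivity) hN
  rw [tsub_le_iff_right]
  set G : Set (Set (ℙ F (Fin n → F))) :=
    {E | ¬ ((projectiveGeometry F n).restrict E).IsDecomposable b c}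
  set B : Set (Set (ℙ F (Fin n → F))) :=
    {E | (E.ncard : ℝ) < p / 2 * Nat.card (ℙ F (Fin n → F))}
  have hcover : Set.univ ⊆ G ∪ B := fun E _ => by
    by_cases hE : (E.ncard : ℝ) < p / 2 * Nat.card (ℙ F (Fin n → F))
    · exact Or.inr hE
    · refine Or.inl (hdec E (le_trans ?_ (not_lt.mp hE)))
      calc (p : ℝ) / 2 / Nat.card F * (Nat.card F : ℝ) ^ n
          = p / 2 * ((Nat.card F : ℝ) ^ n / Nat.card F) := by ring
        _ ≤ _ := by gcongr
  have hB := setBernoulli_ncard_lt_le (ι := ℙ F (Fin n → F)) p hp (by exact_mod_cast hN0)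
  calc (1 : ENNReal)
      = ProbabilityTheory.setBernoulli (Set.univ : Set (ℙ F (Fin n → F))) p Set.univ :=
        MeasureTheory.measure_univ.symm
    _ ≤ _ := MeasureTheory.measure_mono hcover
    _ ≤ _ := MeasureTheory.measure_union_le _ _
    _ ≤ _ := by
        gcongr
        refine hB.trans (ENNReal.ofReal_le_ofReal ?_)
        gcongr
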